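/- Let $K$ be a compact Lie group, $H\subset K$ a closed subgroup, and let $M=K/H$ be the corresponding homogeneous manifold, of positive dimension. Let $G$ be a Lie group whose Lie algebra $\mathfrak g$ carries an $\mathrm{Ad}(G)$-invariant non-degenerate bilinear form $B$, let $\pi:P\to M$ be a smooth principal $G$-bundle with a connection form $\theta$, horizontal distribution $\mathcal H=\ker\theta$ and curvature form $\Omega$, and let $L\subset G$ be a closed subgroup with Lie algebra $\mathfrak l$. Put $\mathfrak l^\perp=\{u\in\mathfrak g : B(x,u)=0 \text{ for all } x\in\mathfrak l\}$. The associated bundle $G/L\to P/L\to M$ is called *fat* with respect to $\theta$ if for every non-zero $u\in\mathfrak l^{\perp}$ and every $p\in P$ the 2-form $(X,Y)\mapsto B(\Omega_p(X,Y),u)$ is non-degenerate on $\mathcal H_p$. Assume that it is fat. 1. For every $p\in P$, let $\mathfrak h'_p\subset\mathfrak g$ be the Lie subalgebra generated by all $\Omega_p(X,Y)$ with $X,Y\in\mathcal H_p$. Then $\mathfrak g=\mathfrak h'_p+\mathfrak l$. 2. Suppose in addition that $K$ acts smoothly on $P$ by principal bundle automorphisms covering the left translations of $K/H$ (for example, that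 $P$ is a $K$-invariant $G$-structure on $K/H$ with the induced action $k\cdot u=d\tau(k)\circ u$ on frames, $\tau(k)$ being the left translation by $k$), that $\mathfrak k=\mathfrak h\oplus\mathfrak m$ with $\mathrm{Ad}(H)\mathfrak m\subset\mathfrak m$, that $u_0\in P$ lies over the base point $eH$, and let $\lambda:H\to G$ be the isotropy homomorphism defined by $h\cdot u_0=u_0\cdot\lambda(h)$. If $\theta$ is the canonical connection, i.e. $\theta$ is $K$-invariant and the linear map $\Lambda:\mathfrak k\to\mathfrak g$, $\Lambda(X)=\theta_{u_0}(X^*_{u_0})$ (where $X^*$ is the vector field on $P$ generated by $X$), vanishes on $\mathfrak m$, then $\mathfrak g=\lambda_*(\mathfrak h)+\mathfrak l$ (that is, $\mathfrak g=\mathfrak h+\mathfrak l$ once $\mathfrak h$ is identified with its image $\lambda_*(\mathfrak h)$ in $\mathfrak g$). -/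

import Mathlib

open scoped Manifold ContDiff
open MulOpposite Manifold

noncomputable section

/-- A smooth real Lie group is `C^3`; this gives access to Mathlib's Lie bracket on its
tangent space at the identity. -/
instance lieGroup_minSmoothness {E : Type*} [NormedAddCommGroup E] [NormedSpace ℝ E]
    {G : Type*} [TopologicalSpace G] [ChartedSpace E G] [Group G] [LieGroup 𝓘(ℝ, E) ∞ G] :
    LieGroup 𝓘(ℝ, E) (minSmoothness ℝ 3) G :=
  LieGroup.of_le (n := ∞) (by rw [minSmoothness_of_isRCLikeNormedField]; exact ENat.LEInfty.out)

namespace FatBundle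

section Calculus

variable {E E' V : Type*} [NormedAddCommGroup E] [NormedSpace ℝ E]
  [NormedAddCommGroup E'] [NormedSpace ℝ E'] [NormedAddCommGroup V] [NormedSpace ℝ V]

/-- The differential of `f` at `x`, with values in the tangent space at `y = f x`. -/
def diffTo {M : Type*} [TopologicalSpace M] [ChartedSpace E M]
    {N : Type*} [TopologicalSpace N] [ChartedSpace E' N]
    (f : M → N) (x : M) {y : N} (h : f x = y) :
    TangentSpace 𝓘(ℝ, E) x →L[ℝ] TangentSpace 𝓘(ℝ, E') y :=
  h ▸ mfderiv 𝓘(ℝ, E) 𝓘(ℝ, E') f x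

/-- The coordinate expression, in the preferred chart at `p`, of a `V`-valued one-form `θ`
on a manifold: the pullback of `θ` by the inverse of the chart. -/
def oneFormInChart {P : Type*} [TopologicalSpace P] [ChartedSpace E P]
    (θ : ∀ p : P, TangentSpace 𝓘(ℝ, E) p →L[ℝ] V) (p : P) (x : E) : E →L[ℝ] V :=
  (θ ((extChartAt 𝓘(ℝ, E) p).symm x)).comp
    (mfderiv 𝓘(ℝ, E) 𝓘(ℝ, E) (extChartAt 𝓘(ℝ, E) p).symm x)

/-- The exterior derivative `dθ` of a `V`-valued one-form on a manifold, evaluated at the point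
`p` on the tangent vectors `v`, `w`; computed in the preferred chart at `p`. -/
def extDerivOneForm {P : Type*} [TopologicalSpace P] [ChartedSpace E P]
    (θ : ∀ p : P, TangentSpace 𝓘(ℝ, E) p →L[ℝ] V) (p : P) (v w : TangentSpace 𝓘(ℝ, E) p) : V :=
  extDeriv (fun x => ContinuousAlternatingMap.ofSubsingleton ℝ E V (0 : Fin 1)
      (oneFormInChart θ p x)) (extChartAt 𝓘(ℝ, E) p p)
    ![mfderiv 𝓘(ℝ, E) 𝓘(ℝ, E) (extChartAt 𝓘(ℝ, E) p) p v,
      mfderiv 𝓘(ℝ, E) 𝓘(ℝ, E) (extChartAt 𝓘(ℝ, E) p) p w]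

end Calculus

section LieGroups

variable {E E' : Type*} [NormedAddCommGroup E] [NormedSpace ℝ E]
  [NormedAddCommGroup E'] [NormedSpace ℝ E']
  {G : Type*} [TopologicalSpace G] [ChartedSpace E G] [Group G]
  {G' : Type*} [TopologicalSpace G'] [ChartedSpace E' G'] [Group G']

/-- The linear map of Lie algebras induced by a homomorphism of Lie groups. -/
def lieMap (f : G →* G') : GroupLieAlgebra 𝓘(ℝ, E) G →L[ℝ] GroupLieAlgebra 𝓘(ℝ, E') G' :=
  diffTo f 1 (map_one f)

/-- The adjoint representation: `Ad g` is the differential at `1` of `x ↦ g x g⁻¹`. -/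
def Ad (g : G) : GroupLieAlgebra 𝓘(ℝ, E) G →L[ℝ] GroupLieAlgebra 𝓘(ℝ, E) G :=
  lieMap (MulAut.conj g).toMonoidHom

/-- The Lie algebra of a Lie subgroup `L` of `G`, as a subspace of the Lie algebra of `G`: the
image of the Lie algebra of `L` under the differential of the inclusion. -/
def subgroupLie (L : Subgroup G) [ChartedSpace E' L] :
    Submodule ℝ (GroupLieAlgebra 𝓘(ℝ, E) G) :=
  (lieMap (E := E') (E' := E) L.subtype).range

/-- `Ad`-invariance of a bilinear form on the Lie algebra of `G`. -/
def AdInvariant (B : LinearMap.BilinForm ℝ (GroupLieAlgebra 𝓘(ℝ, E) G)) : Prop :=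
  ∀ (g : G) (x y : GroupLieAlgebra 𝓘(ℝ, E) G), B (Ad g x) (Ad g y) = B x y

/-- A closed subgroup `L` of the Lie group `G` with its Lie group structure, that is, the one
which makes it an embedded submanifold. -/
structure IsClosedLieSubgroup (L : Subgroup G) [ChartedSpace E' L] : Prop where
  isClosed : IsClosed (L : Set G)
  lieGroup : LieGroup 𝓘(ℝ, E') ∞ L
  isSmoothEmbedding : IsSmoothEmbedding 𝓘(ℝ, E') 𝓘(ℝ, E) ∞ (L.subtype : L → G)

end LieGroups

section Bundles

variable {EM EG EP : Type*} [NormedAddCommGroup EM] [NormedSpace ℝ EM]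
  [NormedAddCommGroup EG] [NormedSpace ℝ EG] [NormedAddCommGroup EP] [NormedSpace ℝ EP]
  {M : Type*} [TopologicalSpace M] [ChartedSpace EM M]
  {G : Type*} [TopologicalSpace G] [ChartedSpace EG G] [Group G]
  {P : Type*} [TopologicalSpace P] [ChartedSpace EP P] [MulAction Gᵐᵒᵖ P]

variable (EM EG EP G) in
/-- `π : P → M` is a smooth principal `G`-bundle. The right action `p · g` of `G` on `P` is
`op g • p`. -/
structure IsPrincipalBundle (π : P → M) : Prop where
  smooth_proj : ContMDiff 𝓘(ℝ, EP) 𝓘(ℝ, EM) ∞ π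
  smooth_action : ContMDiff (𝓘(ℝ, EP).prod 𝓘(ℝ, EG)) 𝓘(ℝ, EP) ∞
    (fun x : P × G => op x.2 • x.1)
  proj_smul : ∀ (g : G) (p : P), π (op g • p) = π p
  /-- Local triviality: near every point of the base there is a `G`-equivariant diffeomorphism
  over the base between `π⁻¹(U)` and `U × G`. -/
  locally_trivial : ∀ x : M, ∃ e : Bundle.Trivialization G π, x ∈ e.baseSet ∧
    ContMDiffOn 𝓘(ℝ, EP) (𝓘(ℝ, EM).prod 𝓘(ℝ, EG)) ∞ e e.source ∧
    ContMDiffOn (𝓘(ℝ, EM).prod 𝓘(ℝ, EG)) 𝓘(ℝ, EP) ∞ e.toOpenPartialHomeomorph.symm e.target ∧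
    ∀ p ∈ e.source, ∀ g : G, (e (op g • p)).2 = (e p).2 * g

/-- `G` acts simply transitively on the fibres of a principal bundle. -/
theorem IsPrincipalBundle.existsUnique_smul {π : P → M}
    (hP : IsPrincipalBundle EM EG EP G π) {p q : P} (h : π q = π p) :
    ∃! g : G, q = op g • p := by
  obtain ⟨e, hx, -, -, heq⟩ := hP.locally_trivial (π p)
  have hp : p ∈ e.source := by rw [e.source_eq]; exact hx
  have hq : q ∈ e.source := by rw [e.source_eq, Set.mem_preimage, h]; exact hx
  have hg : ∀ g : G, op g • p ∈ e.source := fun g => by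
    rw [e.source_eq, Set.mem_preimage, hP.proj_smul]; exact hx
  refine ⟨(e p).2⁻¹ * (e q).2, ?_, ?_⟩
  · refine e.injOn hq (hg _) (Prod.ext ?_ ?_)
    · rw [e.proj_toFun _ hq, e.proj_toFun _ (hg _), hP.proj_smul, h]
    · exact (mul_inv_cancel_left _ _).symm.trans (heq p hp _).symm
  · rintro g rfl
    rw [heq p hp, inv_mul_cancel_left]

/-- The value at `p` of the fundamental vector field on `P` generated by an element of the Lie
algebra of `G`. -/
def fundamental (p : P) : GroupLieAlgebra 𝓘(ℝ, EG) G →L[ℝ] TangentSpace 𝓘(ℝ, EP) p :=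
  diffTo (fun g : G => op g • p) 1 (by simp)

/-- `θ` is the connection form of a principal connection on `P`: a smooth one-form with values in
the Lie algebra of `G`, reproducing the generators of the fundamental vector fields, and
with `R_g^* θ = Ad(g⁻¹) θ`. -/
structure IsConnectionForm [IsManifold 𝓘(ℝ, EP) ∞ P]
    (θ : ∀ p : P, TangentSpace 𝓘(ℝ, EP) p →L[ℝ] GroupLieAlgebra 𝓘(ℝ, EG) G) : Prop where
  smooth : ContMDiff (M' := EG) 𝓘(ℝ, EP).tangent 𝓘(ℝ, EG) ∞
    (fun v : TangentBundle 𝓘(ℝ, EP) P => θ v.1 v.2)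
  apply_fundamental : ∀ (p : P) (A : GroupLieAlgebra 𝓘(ℝ, EG) G), θ p (fundamental p A) = A
  equivariant : ∀ (g : G) (p : P) (v : TangentSpace 𝓘(ℝ, EP) p),
    θ (op g • p) (mfderiv 𝓘(ℝ, EP) 𝓘(ℝ, EP) (fun q : P => op g • q) p v) = Ad g⁻¹ (θ p v)

variable (θ : ∀ p : P, TangentSpace 𝓘(ℝ, EP) p →L[ℝ] GroupLieAlgebra 𝓘(ℝ, EG) G)

/-- The horizontal space at `p`. -/
def horizontal (p : P) : Submodule ℝ (TangentSpace 𝓘(ℝ, EP) p) := (θ p).ker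

/-- The horizontal component of a tangent vector. -/
def horizontalPart (p : P) (v : TangentSpace 𝓘(ℝ, EP) p) : TangentSpace 𝓘(ℝ, EP) p :=
  v - fundamental p (θ p v)

/-- The curvature form `Ω(v, w) = dθ(hor v, hor w)` of a connection form. -/
def curvature (p : P) (v w : TangentSpace 𝓘(ℝ, EP) p) : GroupLieAlgebra 𝓘(ℝ, EG) G :=
  extDerivOneForm (V := EG) θ p (horizontalPart θ p v) (horizontalPart θ p w)

/-- The Lie subalgebra of the Lie algebra of `G` generated by the values of the curvature at `p`
on horizontal vectors. -/
def curvatureAlgebra [LieGroup 𝓘(ℝ, EG) ∞ G] [CompleteSpace EG] (p : P) :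
    LieSubalgebra ℝ (GroupLieAlgebra 𝓘(ℝ, EG) G) :=
  LieSubalgebra.lieSpan ℝ (GroupLieAlgebra 𝓘(ℝ, EG) G)
    {A | ∃ X ∈ horizontal θ p, ∃ Y ∈ horizontal θ p, A = curvature θ p X Y}

/-- The vector `u` is fat: `B(Ω(·,·), u)` is non-degenerate on every horizontal space. -/
def IsFatVector (B : LinearMap.BilinForm ℝ (GroupLieAlgebra 𝓘(ℝ, EG) G))
    (u : GroupLieAlgebra 𝓘(ℝ, EG) G) : Prop :=
  ∀ p : P, ∀ X ∈ horizontal θ p, X ≠ 0 → ∃ Y ∈ horizontal θ p, B (curvature θ p X Y) u ≠ 0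

/-- The associated bundle `G/L → P/L → M` is fat with respect to the connection `θ`: every non-zero
vector orthogonal to the Lie algebra of `L` is fat. -/
def IsFatAssociatedBundle {EL : Type*} [NormedAddCommGroup EL] [NormedSpace ℝ EL]
    (B : LinearMap.BilinForm ℝ (GroupLieAlgebra 𝓘(ℝ, EG) G))
    (L : Subgroup G) [ChartedSpace EL L] : Prop :=
  ∀ u ∈ B.orthogonal (subgroupLie (E' := EL) L), u ≠ 0 → IsFatVector θ B u

end Bundles

section Invariant

variable {EK EH EM EG EP : Type*} [NormedAddCommGroup EK] [NormedSpace ℝ EK]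
  [NormedAddCommGroup EH] [NormedSpace ℝ EH] [NormedAddCommGroup EM] [NormedSpace ℝ EM]
  [NormedAddCommGroup EG] [NormedSpace ℝ EG] [NormedAddCommGroup EP] [NormedSpace ℝ EP]
  {K : Type*} [TopologicalSpace K] [ChartedSpace EK K] [Group K]
  {H : Subgroup K} [ChartedSpace EM (K ⧸ H)]
  {G : Type*} [TopologicalSpace G] [ChartedSpace EG G] [Group G]
  {P : Type*} [TopologicalSpace P] [ChartedSpace EP P] [MulAction Gᵐᵒᵖ P] [MulAction K P]

variable (EK EP G) in
/-- The action of `K` on the principal `G`-bundle `π : P → K/H` is a smooth action by bundle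
automorphisms which lifts the action of `K` on `K/H` by left translations. For a `K`-invariant
`G`-structure, a bundle `P` of linear frames `u` of `K/H`, it is `k · u = dτ(k) ∘ u`. -/
structure IsLiftedAction (π : P → K ⧸ H) : Prop where
  smooth : ContMDiffSMul 𝓘(ℝ, EK) 𝓘(ℝ, EP) ∞ K P
  comm : ∀ (k : K) (g : G) (p : P), k • (op g • p) = op g • (k • p)
  covers : ∀ (k : K) (p : P), π (k • p) = k • π p

set_option linter.unusedSectionVars false in
theorem smul_mem_fibre {π : P → K ⧸ H} (hK : IsLiftedAction EK EP G π)
    {u₀ : P} (hu : π u₀ = QuotientGroup.mk 1) (h : H) : π ((h : K) • u₀) = π u₀ := by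
  rw [hK.covers, hu]
  exact QuotientGroup.eq.mpr (by simp)

/-- The isotropy homomorphism `λ : H → G` at a point `u₀` of `P` over the base point of `K/H`:
`h · u₀ = u₀ · λ(h)`. -/
def isotropyHom {π : P → K ⧸ H} (hP : IsPrincipalBundle EM EG EP G π)
    (hK : IsLiftedAction EK EP G π) {u₀ : P} (hu : π u₀ = QuotientGroup.mk 1) : H →* G :=
  MonoidHom.mk' (fun h => (hP.existsUnique_smul (smul_mem_fibre hK hu h)).choose) (by
    intro a b
    have key := fun h : H => (hP.existsUnique_smul (smul_mem_fibre hK hu h)).choose_spec.1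
    refine (hP.existsUnique_smul (smul_mem_fibre hK hu (a * b))).unique (key (a * b)) ?_
    have hb := key b
    have ha := key a
    simp only at ha hb ⊢
    rw [op_mul, mul_smul, ← ha, ← hK.comm, ← hb, Subgroup.coe_mul, mul_smul])

theorem smul_eq_isotropyHom {π : P → K ⧸ H} (hP : IsPrincipalBundle EM EG EP G π)
    (hK : IsLiftedAction EK EP G π) {u₀ : P} (hu : π u₀ = QuotientGroup.mk 1) (h : H) :
    (h : K) • u₀ = op (isotropyHom hP hK hu h) • u₀ :=
  (hP.existsUnique_smul (smul_mem_fibre hK hu h)).choose_spec.1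

/-- `𝔨 = 𝔥 ⊕ 𝔪` with `Ad(H) 𝔪 ⊆ 𝔪`. -/
structure IsReductiveComplement (H : Subgroup K) [ChartedSpace EH H]
    (m : Submodule ℝ (GroupLieAlgebra 𝓘(ℝ, EK) K)) : Prop where
  isCompl : IsCompl (subgroupLie (E' := EH) H) m
  ad_mem : ∀ h ∈ H, ∀ X ∈ m, Ad h X ∈ m

/-- The linear map `Λ : 𝔨 → 𝔤`, `Λ(X) = θ(X*)` at `u₀`, where `X*` is the vector field on `P`
generated by `X`. -/
def wangMap (θ : ∀ p : P, TangentSpace 𝓘(ℝ, EP) p →L[ℝ] GroupLieAlgebra 𝓘(ℝ, EG) G) (u₀ : P) :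
    GroupLieAlgebra 𝓘(ℝ, EK) K →L[ℝ] GroupLieAlgebra 𝓘(ℝ, EG) G :=
  (θ u₀).comp (diffTo (fun k : K => k • u₀) 1 (one_smul K u₀))

/-- `θ` is the canonical connection determined by `𝔨 = 𝔥 ⊕ 𝔪`: it is `K`-invariant and the
corresponding map `Λ : 𝔨 → 𝔤` vanishes on `𝔪`. -/
structure IsCanonicalConnection
    (θ : ∀ p : P, TangentSpace 𝓘(ℝ, EP) p →L[ℝ] GroupLieAlgebra 𝓘(ℝ, EG) G)
    (m : Submodule ℝ (GroupLieAlgebra 𝓘(ℝ, EK) K)) (u₀ : P) : Prop where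
  invariant : ∀ (k : K) (p : P) (v : TangentSpace 𝓘(ℝ, EP) p),
    θ (k • p) (mfderiv 𝓘(ℝ, EP) 𝓘(ℝ, EP) (fun q : P => k • q) p v) = θ p v
  wangMap_eq_zero : ∀ X ∈ m, wangMap θ u₀ X = 0

end Invariant

end FatBundle

end

/-! Both conclusions come from one duality argument, `IsFatAssociatedBundle.sup_eq_top`. Let a
subspace `S` of `𝔤` contain all curvature values at one point. If `S + 𝔩` were proper,
non-degeneracy of `B` would give a non-zero `u` orthogonal to it. This `u` lies in `𝔩^⊥`, so it is
fat, yet `B(Ω(X,Y),u) = 0` for all horizontal `X`, `Y`. That is impossible, since horizontal spaces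
have dimension `dim M > 0`.

For the first conclusion `S` is the algebra generated by the curvature. For the second, `S =
λ_*(𝔥)`, and what remains is that `Ω` at `u₀` takes values there. Let `f(k) = k · u₀`. By invariance
of `θ`, the form `f^*θ` takes values in the range of `Λ` (`apply_mfderiv_orbit_mem`), which is
`λ_*(𝔥)` because `Λ` is `λ_*` on `𝔥` and zero on `𝔪` (`IsCanonicalConnection.range_wangMap`). Hence
`d(f^*θ) = f^*dθ` takes values there too (`extDerivOneForm_mem_of_pullback_mem`). Every horizontal
vector at `u₀` is the image under `df` of an element of `𝔪`
(`IsCanonicalConnection.exists_eq_of_mem_horizontal`), so this covers all of `Ω`. No explicit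
bracket formula for the curvature is needed. -/

namespace FatBundle

/-! ### Derivatives of maps with values in a closed subspace -/

section Derivatives

open Filter Topology

/-- If `f` takes values in a closed subspace near `x`, so does its derivative at `x`. -/
theorem _root_.HasFDerivAt.mem_of_eventually_mem {E F : Type*} [NormedAddCommGroup E]
    [NormedSpace ℝ E] [NormedAddCommGroup F] [NormedSpace ℝ F] {f : E → F} {f' : E →L[ℝ] F} {x : E}
    (hf : HasFDerivAt f f' x) {S : Submodule ℝ F} (hS : IsClosed (S : Set F))
    (hmem : ∀ᶠ y in 𝓝 x, f y ∈ S) (v : E) : f' v ∈ S := by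
  -- The derivative is the limit of the quotients `c • (f (x + c⁻¹ • v) - f x)` as `c → ∞`, which
  -- eventually lie in `S`.
  refine hS.mem_of_tendsto (hf.lim_real v) ?_
  have hlim : Tendsto (fun c : ℝ => x + c⁻¹ • v) atTop (𝓝 x) := by
    have h : Tendsto (fun c : ℝ => x + c⁻¹ • v) atTop (𝓝 (x + (0 : ℝ) • v)) :=
      (tendsto_inv_atTop_zero.smul_const v).const_add x
    simpa using h
  filter_upwards [hlim.eventually hmem] with c hc
  exact S.smul_mem c (S.sub_mem hc hmem.self_of_nhds)

/-- If a differential form takes values in a closed subspace near `x`, so does its exterior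
derivative at `x`. -/
theorem extDeriv_mem_of_eventually_mem {E F : Type*} [NormedAddCommGroup E] [NormedSpace ℝ E]
    [NormedAddCommGroup F] [NormedSpace ℝ F] {n : ℕ} {η : E → E [⋀^Fin n]→L[ℝ] F} {x : E}
    (hη : DifferentiableAt ℝ η x) {S : Submodule ℝ F} (hS : IsClosed (S : Set F))
    (hmem : ∀ᶠ y in 𝓝 x, ∀ v, η y v ∈ S) (v : Fin (n + 1) → E) : extDeriv η x v ∈ S := by
  rw [extDeriv_apply hη]
  refine S.sum_mem fun i _ => ?_
  have hi : fderiv ℝ (η · (i.removeNth v)) x (v i) ∈ S := by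
    refine HasFDerivAt.mem_of_eventually_mem
      (DifferentiableAt.hasFDerivAt ?_) hS (hmem.mono fun y hy => hy _) (v i)
    exact ((ContinuousAlternatingMap.apply ℝ E F (i.removeNth v)).differentiableAt.comp x hη)
  rcases neg_one_pow_eq_or ℤ (i : ℕ) with h | h <;> simp [h, hi]

end Derivatives

/-! ### One-forms in charts and naturality of the exterior derivative -/

section Forms

open Filter Topology

variable {E E' V : Type*} [NormedAddCommGroup E] [NormedSpace ℝ E]
  [NormedAddCommGroup E'] [NormedSpace ℝ E'] [NormedAddCommGroup V] [NormedSpace ℝ V]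
  {P : Type*} [TopologicalSpace P] [ChartedSpace E P]
  {N : Type*} [TopologicalSpace N] [ChartedSpace E' N]

theorem diffTo_apply (f : N → P) (x : N) {y : P} (h : f x = y) (v : TangentSpace 𝓘(ℝ, E') x) :
    diffTo f x h v = (mfderiv 𝓘(ℝ, E') 𝓘(ℝ, E) f x v : E) := by
  subst h; rfl

/-- The coordinate expression of a smooth one-form is differentiable. -/
theorem differentiableAt_oneFormInChart [FiniteDimensional ℝ E] [IsManifold 𝓘(ℝ, E) ∞ P]
    {θ : ∀ p : P, TangentSpace 𝓘(ℝ, E) p →L[ℝ] V}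
    (hθ : ContMDiff 𝓘(ℝ, E).tangent 𝓘(ℝ, V) ∞ (fun v : TangentBundle 𝓘(ℝ, E) P => θ v.1 v.2))
    (p : P) : DifferentiableAt ℝ (oneFormInChart θ p) (extChartAt 𝓘(ℝ, E) p p) := by
  have hopen : IsOpen (extChartAt 𝓘(ℝ, E) p).target := isOpen_extChartAt_target p
  suffices h : ContDiffOn ℝ ∞ (oneFormInChart θ p) (extChartAt 𝓘(ℝ, E) p).target from
    (h.contDiffAt (hopen.mem_nhds (mem_extChartAt_target p))).differentiableAt (by simp)
  -- In finite dimension, smoothness of an operator-valued map can be tested on each fixed vector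
  -- `v`. There the map is `θ` composed with the tangent map of the inverse chart along the constant
  -- field `v`.
  rw [contDiffOn_clm_apply]
  intro v
  rw [← contMDiffOn_iff_contDiffOn]
  have h₁ : ContMDiff 𝓘(ℝ, E) 𝓘(ℝ, E).tangent ∞
      (fun x : E => (⟨x, v⟩ : TangentBundle 𝓘(ℝ, E) E)) := by
    exact contMDiff_vectorSpace_iff_contDiff.mpr contDiff_const
  have h₂ := (contMDiffOn_extChartAt_symm (I := 𝓘(ℝ, E)) (n := ∞) p).contMDiffOn_tangentMapWithin
    (m := ∞) (by simp) hopen.uniqueMDiffOn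
  refine ((hθ.comp_contMDiffOn h₂).comp h₁.contMDiffOn fun x hx => hx).congr fun x hx => ?_
  simp only [oneFormInChart, Function.comp_apply, tangentMapWithin,
    mfderivWithin_of_isOpen hopen hx]
  rfl

/-- If the pullback of a smooth one-form by a smooth map takes values in a closed subspace, the
exterior derivative takes values there on the tangent vectors in the image of the differential. -/
theorem extDerivOneForm_mem_of_pullback_mem [FiniteDimensional ℝ E] [IsManifold 𝓘(ℝ, E) ∞ P]
    [IsManifold 𝓘(ℝ, E') ∞ N] {θ : ∀ p : P, TangentSpace 𝓘(ℝ, E) p →L[ℝ] V}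
    (hθ : ContMDiff 𝓘(ℝ, E).tangent 𝓘(ℝ, V) ∞ (fun v : TangentBundle 𝓘(ℝ, E) P => θ v.1 v.2))
    {f : N → P} (hf : ContMDiff 𝓘(ℝ, E') 𝓘(ℝ, E) ∞ f) {S : Submodule ℝ V}
    (hS : IsClosed (S : Set V))
    (hmem : ∀ y v, θ (f y) (mfderiv 𝓘(ℝ, E') 𝓘(ℝ, E) f y v) ∈ S) (x : N)
    (v w : TangentSpace 𝓘(ℝ, E') x) :
    extDerivOneForm θ (f x) (mfderiv 𝓘(ℝ, E') 𝓘(ℝ, E) f x v)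
      (mfderiv 𝓘(ℝ, E') 𝓘(ℝ, E) f x w) ∈ S := by
  set φ := extChartAt 𝓘(ℝ, E') x with hφ
  set ψ := extChartAt 𝓘(ℝ, E) (f x) with hψ
  set F : E' → E := ψ ∘ f ∘ φ.symm with hF
  have hφopen : IsOpen φ.target := isOpen_extChartAt_target x
  have hφx : φ x ∈ φ.target := mem_extChartAt_target x
  have hφs : φ.symm (φ x) = x := extChartAt_to_inv x
  have hfs : ContMDiffOn 𝓘(ℝ, E') 𝓘(ℝ, E) ∞ (f ∘ φ.symm) φ.target :=
    hf.comp_contMDiffOn (contMDiffOn_extChartAt_symm x)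
  have hsrc : ∀ᶠ y in 𝓝 (φ x), y ∈ φ.target ∧ f (φ.symm y) ∈ ψ.source := by
    refine Filter.Eventually.and (hφopen.mem_nhds hφx) ?_
    refine (hfs.continuousOn.continuousAt (hφopen.mem_nhds hφx)).eventually_mem ?_
    simp only [Function.comp_apply, hφs]
    exact extChartAt_source_mem_nhds _
  have hψm : ∀ q ∈ ψ.source, ContMDiffAt 𝓘(ℝ, E) 𝓘(ℝ, E) ∞ ψ q := fun q hq =>
    contMDiffAt_extChartAt' (by simpa [hψ] using hq)
  have hFd : ∀ y, y ∈ φ.target → f (φ.symm y) ∈ ψ.source → ContMDiffAt 𝓘(ℝ, E') 𝓘(ℝ, E) ∞ F y :=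
    fun y hy hy' => (hψm _ hy').comp y (hfs.contMDiffAt (hφopen.mem_nhds hy))
  have hψopen : IsOpen ψ.target := isOpen_extChartAt_target (f x)
  have hψsymm : ∀ z ∈ ψ.target, MDifferentiableAt 𝓘(ℝ, E) 𝓘(ℝ, E) ψ.symm z := fun z hz =>
    ((contMDiffOn_extChartAt_symm (n := ∞) (f x)).contMDiffAt
      (hψopen.mem_nhds hz)).mdifferentiableAt (by simp)
  have hφsymm : ∀ z ∈ φ.target, MDifferentiableAt 𝓘(ℝ, E') 𝓘(ℝ, E') φ.symm z := fun z hz =>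
    ((contMDiffOn_extChartAt_symm (n := ∞) x).contMDiffAt
      (hφopen.mem_nhds hz)).mdifferentiableAt (by simp)
  set α : E → E [⋀^Fin 1]→L[ℝ] V := fun z =>
    ContinuousAlternatingMap.ofSubsingleton ℝ E V (0 : Fin 1) (oneFormInChart θ (f x) z) with hα
  have hFx : F (φ x) = ψ (f x) := by simp [hF, hφs]
  have hαd : DifferentiableAt ℝ α (F (φ x)) := by
    rw [hFx]
    exact (ContinuousAlternatingMap.ofSubsingletonLIE (𝕜 := ℝ) (E := E) (F := V)
      (0 : Fin 1)).toContinuousLinearEquiv.differentiableAt.comp _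
      (differentiableAt_oneFormInChart hθ (f x))
  have hFc : ContDiffAt ℝ ∞ F (φ x) :=
    (hFd _ hsrc.self_of_nhds.1 hsrc.self_of_nhds.2).contDiffAt
  -- Naturality `d(F^*α) = F^*dα` is used for the coordinate expressions `F` of `f` and `α` of `θ`.
  have hpull := extDeriv_pullback hαd hFc
    (by rw [minSmoothness_of_isRCLikeNormedField]; exact ENat.LEInfty.out)
  have hD : ∀ u : E', fderiv ℝ F (φ x) (mfderiv 𝓘(ℝ, E') 𝓘(ℝ, E') φ x u) =
      mfderiv 𝓘(ℝ, E) 𝓘(ℝ, E) ψ (f x) (mfderiv 𝓘(ℝ, E') 𝓘(ℝ, E) f x u) := fun u => by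
    have heq : F ∘ φ =ᶠ[𝓝 x] ψ ∘ f := by
      filter_upwards [extChartAt_source_mem_nhds (I := 𝓘(ℝ, E')) x] with y hy
      simp [hF, φ.left_inv hy]
    have h₁ := mfderiv_comp_apply (I' := 𝓘(ℝ, E')) x
      (hFc.contMDiffAt.mdifferentiableAt (by simp))
      ((contMDiffAt_extChartAt (n := ∞)).mdifferentiableAt (by simp)) u
    have h₂ := mfderiv_comp_apply (I' := 𝓘(ℝ, E)) x
      ((contMDiffAt_extChartAt (n := ∞)).mdifferentiableAt (by simp))
      (hf.contMDiffAt.mdifferentiableAt (by simp)) u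
    rw [mfderiv_eq_fderiv] at h₁
    exact h₁.symm.trans ((congrArg (fun T : E' →L[ℝ] E => T u) heq.mfderiv_eq).trans h₂)
  -- All tangent spaces are the model space `E`, so a vector can be kept fixed while its base point
  -- is rewritten.
  have hθcongr : ∀ p q : P, p = q → ∀ a : E, θ p a = θ q a := by rintro p _ rfl a; rfl
  have hmem' : ∀ᶠ y in 𝓝 (φ x), ∀ u, oneFormInChart θ (f x) (F y) (fderiv ℝ F y u) ∈ S := by
    -- The chart conditions are needed on a neighbourhood of `y`, not only at `y`, because the germs
    -- of `ψ.symm ∘ F` and `f ∘ φ.symm` are differentiated there.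
    filter_upwards [hsrc.eventually_nhds] with y hy u
    have hyt := hy.self_of_nhds.1
    have hys := hy.self_of_nhds.2
    have heq : ψ.symm ∘ F =ᶠ[𝓝 y] f ∘ φ.symm := hy.mono fun z hz => ψ.left_inv hz.2
    have h₁ := mfderiv_comp_apply (I' := 𝓘(ℝ, E)) y (hψsymm (F y) (ψ.map_source hys))
      ((hFd y hyt hys).mdifferentiableAt (by simp)) u
    have h₂ := mfderiv_comp_apply (I' := 𝓘(ℝ, E')) y (hf.mdifferentiableAt (by simp))
      (hφsymm y hyt) u
    rw [mfderiv_eq_fderiv] at h₁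
    have h₃ := h₁.symm.trans ((congrArg (fun T : E' →L[ℝ] E => T u) heq.mfderiv_eq).trans h₂)
    have h₄ : oneFormInChart θ (f x) (F y) (fderiv ℝ F y u) =
        θ (f (φ.symm y)) (mfderiv 𝓘(ℝ, E') 𝓘(ℝ, E) f (φ.symm y)
          (mfderiv 𝓘(ℝ, E') 𝓘(ℝ, E') φ.symm y u)) :=
      (hθcongr _ _ (ψ.left_inv hys) _).trans (congrArg (θ (f (φ.symm y))) h₃)
    rw [h₄]
    exact hmem _ _
  have hkey : extDeriv (fun y => (α (F y)).compContinuousLinearMap (fderiv ℝ F y)) (φ x)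
      ![mfderiv 𝓘(ℝ, E') 𝓘(ℝ, E') φ x v, mfderiv 𝓘(ℝ, E') 𝓘(ℝ, E') φ x w] ∈ S := by
    refine extDeriv_mem_of_eventually_mem ?_ hS ?_ _
    · refine DifferentiableAt.continuousAlternatingMapCompContinuousLinearMap
        (hαd.comp _ (hFc.differentiableAt (by simp))) ?_
      exact (hFc.fderiv_right (m := 1) (n := ∞)
        (by rw [one_add_one_eq_two]; exact ENat.LEInfty.out)).differentiableAt (by simp)
    · exact hmem'.mono fun y hy u => hy (u 0)
  rw [hpull] at hkey
  convert! hkey using 1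
  rw [extDerivOneForm, ContinuousAlternatingMap.compContinuousLinearMap_apply, hFx]
  congr 1
  ext i : 1
  fin_cases i
  · exact (hD v).symm
  · exact (hD w).symm

end Forms

/-! ### Differentials of submersions -/

section Submersion

variable {E E' : Type*} [NormedAddCommGroup E] [NormedSpace ℝ E]
  [NormedAddCommGroup E'] [NormedSpace ℝ E']
  {M : Type*} [TopologicalSpace M] [ChartedSpace E M]
  {N : Type*} [TopologicalSpace N] [ChartedSpace E' N]

open Filter Topology

/-- The differential of a submersion is surjective. -/
theorem surjective_mfderiv_of_isSubmersionAt {f : M → N} {x : M}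
    (hf : IsSubmersionAt 𝓘(ℝ, E) 𝓘(ℝ, E') ∞ f x) :
    Function.Surjective (mfderiv 𝓘(ℝ, E) 𝓘(ℝ, E') f x) := by
  have hcod := hf.codChart_mem_maximalAtlas
  have hdom := hf.domChart_mem_maximalAtlas
  set φ := hf.domChart
  set ψ := hf.codChart
  have hφx : φ x ∈ φ.target := φ.map_source hf.mem_domChart_source
  have hφs : φ.symm (φ x) = x := φ.left_inv hf.mem_domChart_source
  have hψ : ψ.MDifferentiable 𝓘(ℝ, E') 𝓘(ℝ, E') :=
    ⟨(contMDiffOn_of_mem_maximalAtlas hcod).mdifferentiableOn (by simp),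
      (contMDiffOn_symm_of_mem_maximalAtlas hcod).mdifferentiableOn (by simp)⟩
  have hφ : MDifferentiableAt 𝓘(ℝ, E) 𝓘(ℝ, E) φ.symm (φ x) :=
    (contMDiffAt_symm_of_mem_maximalAtlas hdom hφx).mdifferentiableAt (by simp)
  have hfx : MDifferentiableAt 𝓘(ℝ, E) 𝓘(ℝ, E') f x := hf.contMDiffAt.mdifferentiableAt (by simp)
  set A : E →L[ℝ] E' :=
    (ContinuousLinearMap.fst ℝ E' hf.complement).comp hf.equiv.toContinuousLinearMap
  have hloc : ∀ y ∈ φ.target, ψ (f (φ.symm y)) = A y := fun y hy => by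
    have h := hf.writtenInCharts (show y ∈ (φ.extend 𝓘(ℝ, E)).target by simpa using hy)
    exact h
  -- In adapted charts `f` is the linear surjection `A`. The right-hand side therefore has
  -- surjective differential, and the chain rule on the left passes this to `f`.
  have heq : f ∘ φ.symm =ᶠ[𝓝 (φ x)] ψ.symm ∘ A := by
    filter_upwards [φ.open_target.mem_nhds hφx] with y hy
    have hsrc : f (φ.symm y) ∈ ψ.source := hf.source_subset_preimage_source (φ.map_target hy)
    simp only [Function.comp_apply, ← hloc y hy, ψ.left_inv hsrc]
  have hAx : A (φ x) ∈ ψ.target := by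
    rw [← hloc _ hφx, hφs]
    exact ψ.map_source hf.mem_codChart_source
  have hcomp := heq.mfderiv_eq (I := 𝓘(ℝ, E)) (I' := 𝓘(ℝ, E'))
  have hA : Function.Surjective A := Prod.fst_surjective.comp hf.equiv.surjective
  intro w
  obtain ⟨b, hb⟩ := hψ.symm.mfderiv_surjective hAx w
  obtain ⟨a, rfl⟩ := hA b
  have h₁ := mfderiv_comp_apply_of_eq _ hfx hφ hφs a
  have h₂ := mfderiv_comp_apply (I' := 𝓘(ℝ, E')) _ (hψ.mdifferentiableAt_symm hAx)
    A.mdifferentiableAt a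
  rw [ContinuousLinearMap.mfderiv_eq] at h₂
  exact ⟨_, h₁.symm.trans ((congrArg (fun T : E →L[ℝ] E' => T a) hcomp).trans (h₂.trans hb))⟩

end Submersion

/-! ### Dimension of the horizontal spaces and the duality argument -/

section Fatness

variable {EM EG EP : Type*} [NormedAddCommGroup EM] [NormedSpace ℝ EM]
  [NormedAddCommGroup EG] [NormedSpace ℝ EG] [NormedAddCommGroup EP] [NormedSpace ℝ EP]
  {M : Type*} [TopologicalSpace M] [ChartedSpace EM M]
  {G : Type*} [TopologicalSpace G] [ChartedSpace EG G] [Group G]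
  {P : Type*} [TopologicalSpace P] [ChartedSpace EP P] [MulAction Gᵐᵒᵖ P]

open Module

/-- The total space of a principal bundle has dimension `dim M + dim G`. -/
theorem IsPrincipalBundle.finrank_eq [FiniteDimensional ℝ EM] [FiniteDimensional ℝ EG]
    {π : P → M} (hP : IsPrincipalBundle EM EG EP G π) (p : P) :
    finrank ℝ EP = finrank ℝ EM + finrank ℝ EG := by
  obtain ⟨e, hx, he, he', -⟩ := hP.locally_trivial (π p)
  have hp : p ∈ e.source := by rw [e.source_eq]; exact hx
  have hd : e.toOpenPartialHomeomorph.MDifferentiable 𝓘(ℝ, EP) (𝓘(ℝ, EM).prod 𝓘(ℝ, EG)) :=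
    ⟨he.mdifferentiableOn (by simp), he'.mdifferentiableOn (by simp)⟩
  have h : finrank ℝ EP = finrank ℝ (EM × EG) := (hd.mfderiv hp).toLinearEquiv.finrank_eq
  rw [h, finrank_prod]

/-- The horizontal spaces of a connection have the dimension of the base. -/
theorem IsConnectionForm.finrank_horizontal [FiniteDimensional ℝ EM] [FiniteDimensional ℝ EG]
    [FiniteDimensional ℝ EP] [IsManifold 𝓘(ℝ, EP) ∞ P]
    {π : P → M} (hP : IsPrincipalBundle EM EG EP G π)
    {θ : ∀ p : P, TangentSpace 𝓘(ℝ, EP) p →L[ℝ] GroupLieAlgebra 𝓘(ℝ, EG) G}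
    (hθ : IsConnectionForm θ) (p : P) : finrank ℝ (horizontal θ p) = finrank ℝ EM := by
  have : FiniteDimensional ℝ (TangentSpace 𝓘(ℝ, EP) p) := inferInstanceAs (FiniteDimensional ℝ EP)
  have hsurj :
      LinearMap.range (θ p : TangentSpace 𝓘(ℝ, EP) p →ₗ[ℝ] GroupLieAlgebra 𝓘(ℝ, EG) G) = ⊤ :=
    LinearMap.range_eq_top.mpr fun A => ⟨_, hθ.apply_fundamental p A⟩
  have h :=
    (θ p : TangentSpace 𝓘(ℝ, EP) p →ₗ[ℝ] GroupLieAlgebra 𝓘(ℝ, EG) G).finrank_range_add_finrank_ker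
  rw [hsurj, finrank_top] at h
  have h₁ : finrank ℝ (TangentSpace 𝓘(ℝ, EP) p) = finrank ℝ EM + finrank ℝ EG := hP.finrank_eq p
  have h₂ : finrank ℝ (GroupLieAlgebra 𝓘(ℝ, EG) G) = finrank ℝ EG := rfl
  rw [h₁, h₂] at h
  change finrank ℝ (LinearMap.ker
    (θ p : TangentSpace 𝓘(ℝ, EP) p →ₗ[ℝ] GroupLieAlgebra 𝓘(ℝ, EG) G)) = _
  omega

/-- If the associated bundle is fat, a subspace which contains the values of the curvature on
horizontal vectors at one point spans the Lie algebra of `G` together with that of `L`. -/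
theorem IsFatAssociatedBundle.sup_eq_top [FiniteDimensional ℝ EG] {EL : Type*}
    [NormedAddCommGroup EL] [NormedSpace ℝ EL]
    {θ : ∀ p : P, TangentSpace 𝓘(ℝ, EP) p →L[ℝ] GroupLieAlgebra 𝓘(ℝ, EG) G}
    {B : LinearMap.BilinForm ℝ (GroupLieAlgebra 𝓘(ℝ, EG) G)} (hB : B.Nondegenerate)
    {L : Subgroup G} [ChartedSpace EL L] (hfat : IsFatAssociatedBundle (EL := EL) θ B L)
    {p : P} (hp : horizontal θ p ≠ ⊥) {S : Submodule ℝ (GroupLieAlgebra 𝓘(ℝ, EG) G)}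
    (hS : ∀ X ∈ horizontal θ p, ∀ Y ∈ horizontal θ p, curvature θ p X Y ∈ S) :
    S ⊔ subgroupLie (E' := EL) L = ⊤ := by
  have : FiniteDimensional ℝ (GroupLieAlgebra 𝓘(ℝ, EG) G) :=
    inferInstanceAs (FiniteDimensional ℝ EG)
  by_contra hne
  have hlt := Submodule.finrank_lt hne
  -- For non-degenerate `B` the orthogonal has complementary dimension, which is positive for a
  -- proper subspace.
  have horth : B.orthogonal (S ⊔ subgroupLie (E' := EL) L) ≠ ⊥ := fun h => by
    have hfin := LinearMap.BilinForm.finrank_orthogonal hB (S ⊔ subgroupLie (E' := EL) L)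
    rw [h, finrank_bot] at hfin
    omega
  obtain ⟨u, hu, hu0⟩ := Submodule.exists_mem_ne_zero_of_ne_bot horth
  obtain ⟨X, hX, hX0⟩ := Submodule.exists_mem_ne_zero_of_ne_bot hp
  obtain ⟨Y, hY, hXY⟩ := hfat u
    (LinearMap.BilinForm.orthogonal_le le_sup_right hu) hu0 p X hX hX0
  exact hXY (hu _ (Submodule.mem_sup_left (hS X hX Y hY)))

theorem horizontalPart_of_mem
    (θ : ∀ p : P, TangentSpace 𝓘(ℝ, EP) p →L[ℝ] GroupLieAlgebra 𝓘(ℝ, EG) G) {p : P}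
    {v : TangentSpace 𝓘(ℝ, EP) p} (hv : v ∈ horizontal θ p) : horizontalPart θ p v = v := by
  have h : θ p v = 0 := hv
  rw [horizontalPart, h, map_zero, sub_zero]

end Fatness

/-! ### Invariant connections and orbit maps -/

section Invariant

variable {EK EH EM EG EP : Type*} [NormedAddCommGroup EK] [NormedSpace ℝ EK]
  [NormedAddCommGroup EH] [NormedSpace ℝ EH] [NormedAddCommGroup EM] [NormedSpace ℝ EM]
  [NormedAddCommGroup EG] [NormedSpace ℝ EG] [NormedAddCommGroup EP] [NormedSpace ℝ EP]
  {K : Type*} [TopologicalSpace K] [ChartedSpace EK K] [Group K]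
  {H : Subgroup K} [ChartedSpace EH H] [ChartedSpace EM (K ⧸ H)]
  {G : Type*} [TopologicalSpace G] [ChartedSpace EG G] [Group G]
  {P : Type*} [TopologicalSpace P] [ChartedSpace EP P] [MulAction Gᵐᵒᵖ P] [MulAction K P]

open Filter Topology Module

set_option linter.unusedSectionVars false in
theorem IsLiftedAction.contMDiff_smul_left {π : P → K ⧸ H} (hK : IsLiftedAction EK EP G π) (k : K) :
    ContMDiff 𝓘(ℝ, EP) 𝓘(ℝ, EP) ∞ (fun p : P => k • p) :=
  hK.smooth.contMDiff_smul.comp (contMDiff_const.prodMk contMDiff_id)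

set_option linter.unusedSectionVars false in
theorem IsLiftedAction.contMDiff_orbit {π : P → K ⧸ H} (hK : IsLiftedAction EK EP G π) (u₀ : P) :
    ContMDiff 𝓘(ℝ, EK) 𝓘(ℝ, EP) ∞ (fun k : K => k • u₀) :=
  hK.smooth.contMDiff_smul.comp (contMDiff_id.prodMk contMDiff_const)

/-- The isotropy homomorphism is smooth. -/
theorem contMDiff_isotropyHom [LieGroup 𝓘(ℝ, EG) ∞ G] {π : P → K ⧸ H}
    (hP : IsPrincipalBundle EM EG EP G π) (hK : IsLiftedAction EK EP G π) {u₀ : P}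
    (hu : π u₀ = QuotientGroup.mk 1)
    (hH : ContMDiff 𝓘(ℝ, EH) 𝓘(ℝ, EK) ∞ (H.subtype : H → K)) :
    ContMDiff 𝓘(ℝ, EH) 𝓘(ℝ, EG) ∞ (isotropyHom hP hK hu) := by
  obtain ⟨e, hx, he, -, heq⟩ := hP.locally_trivial (π u₀)
  have hu₀ : u₀ ∈ e.source := by rw [e.source_eq]; exact hx
  have hsrc : ∀ h : H, (h : K) • u₀ ∈ e.source := fun h => by
    rw [e.source_eq, Set.mem_preimage, smul_mem_fibre hK hu h]; exact hx
  -- Equivariance of the trivialization turns the chosen element `λ(h)` into an explicit smooth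
  -- expression.
  have hform : ∀ h : H, isotropyHom hP hK hu h = (e u₀).2⁻¹ * (e ((h : K) • u₀)).2 := fun h => by
    rw [smul_eq_isotropyHom hP hK hu h, heq u₀ hu₀, inv_mul_cancel_left]
  have hsm : ContMDiff 𝓘(ℝ, EH) (𝓘(ℝ, EM).prod 𝓘(ℝ, EG)) ∞ (fun h : H => e ((h : K) • u₀)) :=
    he.comp_contMDiff ((hK.contMDiff_orbit u₀).comp hH) hsrc
  refine ContMDiff.congr ?_ hform
  exact contMDiff_mul_left.comp (contMDiff_snd.comp hsm)

/-- On the Lie algebra of `H`, the map `Λ` is the differential of the isotropy homomorphism. -/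
theorem wangMap_lieMap_subtype [IsManifold 𝓘(ℝ, EP) ∞ P] [LieGroup 𝓘(ℝ, EG) ∞ G] {π : P → K ⧸ H}
    (hP : IsPrincipalBundle EM EG EP G π) (hK : IsLiftedAction EK EP G π) {u₀ : P}
    (hu : π u₀ = QuotientGroup.mk 1)
    (hH : ContMDiff 𝓘(ℝ, EH) 𝓘(ℝ, EK) ∞ (H.subtype : H → K))
    {θ : ∀ p : P, TangentSpace 𝓘(ℝ, EP) p →L[ℝ] GroupLieAlgebra 𝓘(ℝ, EG) G}
    (hθ : IsConnectionForm θ) (X : GroupLieAlgebra 𝓘(ℝ, EH) H) :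
    wangMap θ u₀ (lieMap (E' := EK) H.subtype X) =
      lieMap (E' := EG) (isotropyHom hP hK hu) X := by
  -- Writing the right side as `θ` of a fundamental vector reduces the claim to an equality of
  -- tangent vectors, obtained by differentiating `h · u₀ = u₀ · λ(h)` at `1`.
  rw [← hθ.apply_fundamental u₀ (lieMap (E' := EG) (isotropyHom hP hK hu) X)]
  refine congrArg (θ u₀) ?_
  have hG : ContMDiff 𝓘(ℝ, EG) 𝓘(ℝ, EP) ∞ (fun g : G => op g • u₀) :=
    hP.smooth_action.comp (contMDiff_const.prodMk contMDiff_id)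
  have h₁ := mfderiv_comp_apply_of_eq (I := 𝓘(ℝ, EH)) (1 : H)
    ((hK.contMDiff_orbit u₀).mdifferentiableAt (by simp)) (hH.mdifferentiableAt (by simp))
    (map_one H.subtype) X
  have h₂ := mfderiv_comp_apply_of_eq (I := 𝓘(ℝ, EH)) (1 : H)
    (hG.mdifferentiableAt (by simp))
    ((contMDiff_isotropyHom hP hK hu hH).mdifferentiableAt (by simp))
    (map_one (isotropyHom hP hK hu)) X
  have heq : (fun k : K => k • u₀) ∘ H.subtype =
      (fun g : G => op g • u₀) ∘ isotropyHom hP hK hu :=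
    funext fun h => smul_eq_isotropyHom hP hK hu h
  rw [heq] at h₁
  have h₃ : diffTo (fun k : K => k • u₀) 1 (one_smul K u₀) (lieMap (E' := EK) H.subtype X) =
      (mfderiv 𝓘(ℝ, EK) 𝓘(ℝ, EP) (fun k : K => k • u₀) 1
        (mfderiv 𝓘(ℝ, EH) 𝓘(ℝ, EK) H.subtype 1 X) : EP) :=
    (diffTo_apply (fun k : K => k • u₀) 1 (one_smul K u₀) (lieMap (E' := EK) H.subtype X)).trans
      (congrArg (mfderiv 𝓘(ℝ, EK) 𝓘(ℝ, EP) (fun k : K => k • u₀) 1)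
      (diffTo_apply (E := EK) (H.subtype : H → K) 1 (map_one H.subtype) X))
  have h₄ : fundamental u₀ (lieMap (E' := EG) (isotropyHom hP hK hu) X) =
      (mfderiv 𝓘(ℝ, EG) 𝓘(ℝ, EP) (fun g : G => op g • u₀) 1
        (mfderiv 𝓘(ℝ, EH) 𝓘(ℝ, EG) (isotropyHom hP hK hu) 1 X) : EP) :=
    (diffTo_apply (fun g : G => op g • u₀) 1 (by rw [op_one, one_smul] : op (1 : G) • u₀ = u₀)
      (lieMap (E' := EG) (isotropyHom hP hK hu) X)).trans
      (congrArg (mfderiv 𝓘(ℝ, EG) 𝓘(ℝ, EP) (fun g : G => op g • u₀) 1)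
      (diffTo_apply (E := EG) (isotropyHom hP hK hu) 1 (map_one (isotropyHom hP hK hu)) X))
  exact h₃.trans (h₁.symm.trans (h₂.trans h₄.symm))

/-- For an invariant form, the pullback to `K` by an orbit map takes values in the range
of `Λ`. -/
theorem apply_mfderiv_orbit_mem [LieGroup 𝓘(ℝ, EK) ∞ K] {π : P → K ⧸ H}
    (hK : IsLiftedAction EK EP G π)
    {θ : ∀ p : P, TangentSpace 𝓘(ℝ, EP) p →L[ℝ] GroupLieAlgebra 𝓘(ℝ, EG) G}
    (hinv : ∀ (k : K) (p : P) (v : TangentSpace 𝓘(ℝ, EP) p),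
      θ (k • p) (mfderiv 𝓘(ℝ, EP) 𝓘(ℝ, EP) (fun q : P => k • q) p v) = θ p v)
    (u₀ : P) (k : K) (v : TangentSpace 𝓘(ℝ, EK) k) :
    θ (k • u₀) (mfderiv 𝓘(ℝ, EK) 𝓘(ℝ, EP) (fun k : K => k • u₀) k v) ∈
      (wangMap (EK := EK) (K := K) θ u₀).range := by
  set f : K → P := fun k => k • u₀ with hf
  have hfm : MDifferentiableAt 𝓘(ℝ, EK) 𝓘(ℝ, EP) f 1 :=
    (hK.contMDiff_orbit u₀).mdifferentiableAt (by simp)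
  have hL : MDifferentiableAt 𝓘(ℝ, EK) 𝓘(ℝ, EK) (k⁻¹ * ·) k :=
    (contMDiff_mul_left (n := ∞)).mdifferentiableAt (by simp)
  have hL1 : k⁻¹ * k = 1 := inv_mul_cancel k
  have hg : MDifferentiableAt 𝓘(ℝ, EK) 𝓘(ℝ, EP) (f ∘ (k⁻¹ * ·)) k := hfm.comp_of_eq k hL hL1
  -- Invariance of `θ` absorbs the outer translation by `k`. What is left is `Λ` at the left
  -- translate of `v` to the identity, the witness below.
  have heq : f = (fun p : P => k • p) ∘ (f ∘ (k⁻¹ * ·)) := by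
    funext x
    simp [hf, smul_smul]
  have hg1 : (f ∘ (k⁻¹ * ·)) k = u₀ := by simp [hf]
  have h₁ := mfderiv_comp_apply_of_eq k
    ((hK.contMDiff_smul_left k).mdifferentiableAt (x := u₀) (by simp)) hg hg1 v
  rw [← heq] at h₁
  have h₂ := mfderiv_comp_apply_of_eq k hfm hL hL1 v
  refine ⟨mfderiv 𝓘(ℝ, EK) 𝓘(ℝ, EK) (k⁻¹ * ·) k v, ?_⟩
  have h₃ := hinv k u₀ (mfderiv 𝓘(ℝ, EK) 𝓘(ℝ, EP) (f ∘ (k⁻¹ * ·)) k v)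
  refine Eq.trans ?_ (h₃.symm.trans (congrArg (θ (k • u₀)) h₁.symm))
  exact congrArg (θ u₀) ((diffTo_apply f 1 (one_smul K u₀) _).trans h₂.symm)

/-- The vectors generated by a reductive complement exhaust the horizontal space of the canonical
connection. -/
theorem IsCanonicalConnection.exists_eq_of_mem_horizontal [FiniteDimensional ℝ EM]
    [FiniteDimensional ℝ EG] [FiniteDimensional ℝ EP] [IsManifold 𝓘(ℝ, EP) ∞ P]
    {π : P → K ⧸ H} (hP : IsPrincipalBundle EM EG EP G π) (hK : IsLiftedAction EK EP G π)
    (hH : ContMDiff 𝓘(ℝ, EH) 𝓘(ℝ, EK) ∞ (H.subtype : H → K))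
    (hKH : IsSubmersion 𝓘(ℝ, EK) 𝓘(ℝ, EM) ∞ (QuotientGroup.mk : K → K ⧸ H))
    {θ : ∀ p : P, TangentSpace 𝓘(ℝ, EP) p →L[ℝ] GroupLieAlgebra 𝓘(ℝ, EG) G}
    (hθ : IsConnectionForm θ) {m : Submodule ℝ (GroupLieAlgebra 𝓘(ℝ, EK) K)}
    (hm : IsReductiveComplement (EH := EH) H m) {u₀ : P} (hu : π u₀ = QuotientGroup.mk 1)
    (hcan : IsCanonicalConnection θ m u₀) {v : TangentSpace 𝓘(ℝ, EP) u₀}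
    (hv : v ∈ horizontal θ u₀) :
    ∃ X ∈ m, diffTo (fun k : K => k • u₀) 1 (one_smul K u₀) X = v := by
  have : FiniteDimensional ℝ (TangentSpace 𝓘(ℝ, EP) u₀) :=
    inferInstanceAs (FiniteDimensional ℝ EP)
  set D : GroupLieAlgebra 𝓘(ℝ, EK) K →L[ℝ] TangentSpace 𝓘(ℝ, EP) u₀ :=
    diffTo (fun k : K => k • u₀) 1 (one_smul K u₀) with hD
  set T := mfderiv 𝓘(ℝ, EP) 𝓘(ℝ, EM) π u₀ with hT
  set Q := mfderiv 𝓘(ℝ, EK) 𝓘(ℝ, EM) (QuotientGroup.mk : K → K ⧸ H) 1 with hQ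
  have hTD : ∀ X, T (D X) = (Q X : EM) := fun X => by
    have heq : π ∘ (fun k : K => k • u₀) = (QuotientGroup.mk : K → K ⧸ H) := by
      funext k
      simp only [Function.comp_apply, hK.covers, hu]
      exact congrArg QuotientGroup.mk (mul_one k)
    have h := mfderiv_comp_apply_of_eq (1 : K) (hP.smooth_proj.mdifferentiableAt (by simp))
      ((hK.contMDiff_orbit u₀).mdifferentiableAt (by simp)) (one_smul K u₀) X
    rw [heq] at h
    exact (congrArg T (diffTo_apply _ _ _ _)).trans h.symm
  have hQH : ∀ X ∈ subgroupLie (E' := EH) H, Q X = 0 := by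
    rintro _ ⟨Y, rfl⟩
    have heq : (QuotientGroup.mk : K → K ⧸ H) ∘ H.subtype = fun _ => QuotientGroup.mk 1 :=
      funext fun h => QuotientGroup.eq.mpr (by simp)
    have h := mfderiv_comp_apply_of_eq (I := 𝓘(ℝ, EH)) (1 : H)
      (hKH.contMDiff.mdifferentiableAt (by simp)) (hH.mdifferentiableAt (by simp))
      (map_one H.subtype) Y
    rw [heq, mfderiv_const] at h
    exact (congrArg Q (diffTo_apply (E := EK) (H.subtype : H → K) 1 (map_one H.subtype) Y)).trans
      h.symm
  -- The differential of `K → K/H` is onto and kills `𝔥`, so it is already onto on `𝔪`.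
  have hQm : ∀ w : EM, ∃ X ∈ m, (Q X : EM) = w := fun w => by
    obtain ⟨X, hX⟩ := surjective_mfderiv_of_isSubmersionAt (hKH.isSubmersionAt 1) w
    obtain ⟨Y, hY, Z, hZ, rfl⟩ := Submodule.mem_sup.mp
      (hm.isCompl.sup_eq_top.symm ▸ Submodule.mem_top (x := X))
    refine ⟨Z, hZ, ?_⟩
    rw [← hX, map_add]
    exact (zero_add (Q Z)).symm.trans (congrArg (· + Q Z) (hQH Y hY).symm)
  have hle : m.map (D : GroupLieAlgebra 𝓘(ℝ, EK) K →ₗ[ℝ] TangentSpace 𝓘(ℝ, EP) u₀) ≤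
      horizontal θ u₀ := by
    rintro _ ⟨X, hX, rfl⟩
    exact hcan.wangMap_eq_zero X hX
  -- Since `T` maps `D(𝔪)` onto the tangent space of `K/H`, `D(𝔪)` has at least the dimension of the
  -- horizontal space containing it; the two coincide.
  have hfin : finrank ℝ (horizontal θ u₀) ≤
      finrank ℝ (m.map (D : GroupLieAlgebra 𝓘(ℝ, EK) K →ₗ[ℝ] TangentSpace 𝓘(ℝ, EP) u₀)) := by
    rw [hθ.finrank_horizontal hP u₀]
    let T' : TangentSpace 𝓘(ℝ, EP) u₀ →ₗ[ℝ] EM := T.toLinearMap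
    refine LinearMap.finrank_le_finrank_of_surjective (f := T'.domRestrict _) ?_
    intro w
    obtain ⟨X, hX, hw⟩ := hQm w
    exact ⟨⟨D X, X, hX, rfl⟩, (hTD X).trans hw⟩
  rw [← Submodule.eq_of_le_of_finrank_le hle hfin] at hv
  exact hv

/-- The exterior derivative of an invariant connection form takes values in the range of `Λ` on the vectors
generated by the action. -/
theorem extDerivOneForm_orbit_mem [LieGroup 𝓘(ℝ, EK) ∞ K] [FiniteDimensional ℝ EG]
    [FiniteDimensional ℝ EP] [IsManifold 𝓘(ℝ, EP) ∞ P]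
    {π : P → K ⧸ H} (hK : IsLiftedAction EK EP G π)
    {θ : ∀ p : P, TangentSpace 𝓘(ℝ, EP) p →L[ℝ] GroupLieAlgebra 𝓘(ℝ, EG) G}
    (hθ : IsConnectionForm θ)
    (hinv : ∀ (k : K) (p : P) (v : TangentSpace 𝓘(ℝ, EP) p),
      θ (k • p) (mfderiv 𝓘(ℝ, EP) 𝓘(ℝ, EP) (fun q : P => k • q) p v) = θ p v)
    (u₀ : P) (X Y : GroupLieAlgebra 𝓘(ℝ, EK) K) :
    extDerivOneForm (V := EG) θ u₀ (diffTo (fun k : K => k • u₀) 1 (one_smul K u₀) X)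
      (diffTo (fun k : K => k • u₀) 1 (one_smul K u₀) Y) ∈
      (wangMap (EK := EK) (K := K) θ u₀).range := by
  let S : Submodule ℝ EG := (wangMap (EK := EK) (K := K) θ u₀).range
  have : IsManifold 𝓘(ℝ, EK) ∞ K := LieGroup.toContMDiffMul.toIsManifold
  have key := extDerivOneForm_mem_of_pullback_mem (V := EG) (S := S) hθ.smooth
    (hK.contMDiff_orbit u₀) S.closed_of_finiteDimensional
    (fun k v => apply_mfderiv_orbit_mem hK hinv u₀ k v) (1 : K) X Y
  -- `key` lives at `1 • u₀`, which equals `u₀` only propositionally.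
  have aux : ∀ (p q : P) (h : p = q) (a b : EP),
      extDerivOneForm (V := EG) θ p a b = extDerivOneForm (V := EG) θ q a b := by
    rintro p _ rfl a b; rfl
  rw [diffTo_apply, diffTo_apply]
  exact (aux _ _ (one_smul K u₀) _ _) ▸ key

/-- The range of `Λ` for the canonical connection is the image of the Lie algebra of `H` under the
differential of the isotropy homomorphism. -/
theorem IsCanonicalConnection.range_wangMap [IsManifold 𝓘(ℝ, EP) ∞ P] [LieGroup 𝓘(ℝ, EG) ∞ G]
    {π : P → K ⧸ H} (hP : IsPrincipalBundle EM EG EP G π) (hK : IsLiftedAction EK EP G π)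
    (hH : ContMDiff 𝓘(ℝ, EH) 𝓘(ℝ, EK) ∞ (H.subtype : H → K))
    {θ : ∀ p : P, TangentSpace 𝓘(ℝ, EP) p →L[ℝ] GroupLieAlgebra 𝓘(ℝ, EG) G}
    (hθ : IsConnectionForm θ) {m : Submodule ℝ (GroupLieAlgebra 𝓘(ℝ, EK) K)}
    (hm : IsReductiveComplement (EH := EH) H m) {u₀ : P} (hu : π u₀ = QuotientGroup.mk 1)
    (hcan : IsCanonicalConnection θ m u₀) :
    (wangMap (EK := EK) (K := K) θ u₀).range =
      (lieMap (E := EH) (E' := EG) (isotropyHom hP hK hu)).range := by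
  refine le_antisymm ?_ ?_
  · rintro _ ⟨X, rfl⟩
    obtain ⟨_, ⟨Y, rfl⟩, Z, hZ, rfl⟩ := Submodule.mem_sup.mp
      (hm.isCompl.sup_eq_top.symm ▸ Submodule.mem_top (x := X))
    refine ⟨Y, ?_⟩
    have h := map_add (wangMap (EK := EK) (K := K) θ u₀) (lieMap (E' := EK) H.subtype Y) Z
    rw [hcan.wangMap_eq_zero Z hZ, add_zero, wangMap_lieMap_subtype hP hK hu hH hθ] at h
    exact h.symm
  · rintro _ ⟨Y, rfl⟩
    exact ⟨_, wangMap_lieMap_subtype hP hK hu hH hθ Y⟩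

end Invariant

end FatBundle

/-! ### The main theorem -/

theorem mainTheorem4 {nK nH d nG nL nP : ℕ}
    -- the compact Lie group `K` and its closed subgroup `H`
    {K : Type*} [TopologicalSpace K] [ChartedSpace (EuclideanSpace ℝ (Fin nK)) K] [Group K]
    [LieGroup (𝓡 nK) ∞ K] [CompactSpace K]
    (H : Subgroup K) [ChartedSpace (EuclideanSpace ℝ (Fin nH)) H]
    (hH : FatBundle.IsClosedLieSubgroup (E := EuclideanSpace ℝ (Fin nK))
      (E' := EuclideanSpace ℝ (Fin nH)) H)
    -- the homogeneous manifold `K/H`, of positive dimension `d`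
    [ChartedSpace (EuclideanSpace ℝ (Fin d)) (K ⧸ H)] [IsManifold (𝓡 d) ∞ (K ⧸ H)]
    (hKH : Manifold.IsSubmersion (𝓡 nK) (𝓡 d) ∞ (QuotientGroup.mk : K → K ⧸ H)) (hd : 0 < d)
    -- the structure group `G`, its closed subgroup `L`, the invariant form on its Lie algebra
    {G : Type*} [TopologicalSpace G] [ChartedSpace (EuclideanSpace ℝ (Fin nG)) G] [Group G]
    [LieGroup (𝓡 nG) ∞ G]
    (L : Subgroup G) [ChartedSpace (EuclideanSpace ℝ (Fin nL)) L]
    (hL : FatBundle.IsClosedLieSubgroup (E := EuclideanSpace ℝ (Fin nG))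
      (E' := EuclideanSpace ℝ (Fin nL)) L)
    (B : LinearMap.BilinForm ℝ (GroupLieAlgebra (𝓡 nG) G)) (hB : B.Nondegenerate)
    (hBinv : FatBundle.AdInvariant B)
    -- the principal bundle `π : P → K/H` with its connection form `θ`
    {P : Type*} [TopologicalSpace P] [ChartedSpace (EuclideanSpace ℝ (Fin nP)) P]
    [IsManifold (𝓡 nP) ∞ P] [MulAction Gᵐᵒᵖ P] (π : P → K ⧸ H)
    (hP : FatBundle.IsPrincipalBundle (EuclideanSpace ℝ (Fin d)) (EuclideanSpace ℝ (Fin nG))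
      (EuclideanSpace ℝ (Fin nP)) G π)
    (θ : ∀ p : P, TangentSpace (𝓡 nP) p →L[ℝ] GroupLieAlgebra (𝓡 nG) G)
    (hθ : FatBundle.IsConnectionForm θ)
    (hfat : FatBundle.IsFatAssociatedBundle (EL := EuclideanSpace ℝ (Fin nL)) θ B L) :
    (∀ p : P, (FatBundle.curvatureAlgebra θ p).toSubmodule ⊔
      FatBundle.subgroupLie (E' := EuclideanSpace ℝ (Fin nL)) L = ⊤) ∧
    (∀ [MulAction K P]
      (hK : FatBundle.IsLiftedAction (EuclideanSpace ℝ (Fin nK)) (EuclideanSpace ℝ (Fin nP)) G π)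
      (m : Submodule ℝ (GroupLieAlgebra (𝓡 nK) K))
      (_ : FatBundle.IsReductiveComplement (EH := EuclideanSpace ℝ (Fin nH)) H m)
      (u₀ : P) (hu₀ : π u₀ = QuotientGroup.mk 1)
      (_ : FatBundle.IsCanonicalConnection θ m u₀),
      (FatBundle.lieMap (E := EuclideanSpace ℝ (Fin nH)) (E' := EuclideanSpace ℝ (Fin nG))
          (FatBundle.isotropyHom hP hK hu₀)).range ⊔
        FatBundle.subgroupLie (E' := EuclideanSpace ℝ (Fin nL)) L = ⊤) := by
  have hhor : ∀ p, FatBundle.horizontal θ p ≠ ⊥ := fun p h => by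
    have hfin := hθ.finrank_horizontal hP p
    rw [h, finrank_bot, finrank_euclideanSpace_fin] at hfin
    omega
  refine ⟨fun p => hfat.sup_eq_top hB (hhor p) fun X hX Y hY =>
    LieSubalgebra.subset_lieSpan ⟨X, hX, Y, hY, rfl⟩, ?_⟩
  intro _ hK m hm u₀ hu₀ hcan
  have hsub := hH.isSmoothEmbedding.contMDiff
  refine hfat.sup_eq_top hB (hhor u₀) fun X hX Y hY => ?_
  -- On horizontal vectors the curvature is just `dθ`, so the orbit-map computation applies once `X`
  -- and `Y` are written as vectors generated by `𝔨`.
  rw [FatBundle.curvature, FatBundle.horizontalPart_of_mem θ hX,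
    FatBundle.horizontalPart_of_mem θ hY]
  obtain ⟨X, -, rfl⟩ := hcan.exists_eq_of_mem_horizontal hP hK hsub hKH hθ hm hu₀ hX
  obtain ⟨Y, -, rfl⟩ := hcan.exists_eq_of_mem_horizontal hP hK hsub hKH hθ hm hu₀ hY
  rw [← hcan.range_wangMap hP hK hsub hθ hm hu₀]
  exact FatBundle.extDerivOneForm_orbit_mem hK hθ hcan.invariant u₀ X Y
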